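/- Let $\mathbb K$ be a field, let $U$ and $V$ be finite-dimensional vector spaces over $\mathbb K$, and let $S$ be a linear subspace of the space $\mathcal L(U,V)$ of all linear maps from $U$ to $V$; write $\operatorname{codim} S$ for its codimension in $\mathcal L(U,V)$. A map $F : S \to V$ is called local if there is $x \in U$ such that $F(s)=s(x)$ for all $s \in S$. It is called quasi-range-compatible if there is a $1$-dimensional linear subspace $D$ of $V$ such that, for every $s \in S$, $D \not\subset \operatorname{im} s$ implies $F(s) \in \operatorname{im} s$. For $i \in \{1,2\}$, the space $S$ is called special of type $i$ if there is $x \in U$ such that the space $Sx=\{s(x) : s \in S\}$ has dimension $i$. A homomorphism on $S$ is a homomorphism of additive groups $S \to V$. Then: (a) If $\#\mathbb K>3$, $\dim V=2$ and $\operatorname{codim} S \le 2\dim V-3$ (that is, $\operatorname{codim} S\le 1$), then either $S$ is special of type $1$ or every quasi-range-compatible linear map from $S$ to $V$ is local. (b) If $\#\mathbb K>2$ and $\operatorname{codim} S \le 2\dim V-4$, then either $S$ is special of type $1$ or every quasi-range-compatible homomorphism on $S$ is local. (c) If $\#\mathbb K=2$ and $\operatorname{codim} S \le 2\dim V-6$,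 then either $S$ is special of type $1$ or of type $2$, or every quasi-range-compatible homomorphism on $S$ is local. -/

import Mathlib

/-!
Let `F` be quasi-range-compatible with respect to the line `K ∙ d`.

The operators of `S` that vanish at `x ≠ 0` form a space of operators on `U ⧸ K ∙ x`, of
codimension `codim S + dim S x - dim V`. If `F` is local on it, then after subtracting an evaluation
`F s = g (s x)` for an additive map `g` on `S x`. Suppose this codimension is at most `dim V - e`.
If `g p` were not in `K ∙ p` for some `p ∈ S x` outside `K ∙ d`, there would be a form `φ` with
`φ p = 0`, `φ d ≠ 0`, `φ (g p) ≠ 0` and some `s ∈ S` with `s x = p` and `φ ∘ s = 0`, contradicting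
`F s ∈ im s`. So `g` has all vectors off a line as eigenvectors, and it is a homothety as soon as no
space of dimension `e` is a union of three lines (`e = 2`, or `e = 3` when `K` has two elements).
By induction on `dim U`, this settles `codim S ≤ dim V - e`.

For `codim S ≤ 2 dim V - 2 e` one inducts on `dim V`. If `dim S x ≤ e` for some `x ≠ 0`, the
operators vanishing at `x` fall under the previous case. Otherwise let `T` be the trace orthogonal
of `S`: passing to `S` modulo `y` preserves the codimension bound when `dim T y ≥ 2`. Such a `y`
exists, for otherwise either `dim T ≤ 1` or all operators of `T` have values in one line `K ∙ u`,
and then `codim S + dim S u = dim V`. As the exceptional `y` are the common zeros of quadratic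
forms, there are even two independent such vectors `y`, `z` outside `K ∙ d`, and the induction
hypothesis gives `F s - s x ∈ K ∙ y` and `F s - s x' ∈ K ∙ z` for all `s`. Then
`dim S (x - x') ≤ 2` forces `x = x'`, whence `F s = s x`.

For `dim V = 2`, each form `φ` with `φ d ≠ 0` has `φ (F s) = φ (s x)` for some `x` depending on `φ`.
Four such forms, and an orthogonal `T` of dimension at most one without operators of rank one, force
their vectors `x` to agree.
-/

/-- A map `F : S → V` on a space `S` of operators from `U` to `V` is *local* when it is the
evaluation at some fixed vector of `U`. -/
def IsLocalMap {K U V : Type*} [Field K] [AddCommGroup U] [Module K U] [AddCommGroup V]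
    [Module K V] {S : Submodule K (U →ₗ[K] V)} (F : S → V) : Prop :=
  ∃ x : U, ∀ s : S, F s = (s : U →ₗ[K] V) x

/-- `F` is *quasi-range-compatible with respect to `D`*: `F s` belongs to the range of `s`
for every `s ∈ S` whose range does not include `D`. -/
def QuasiRangeCompatibleWrt {K U V : Type*} [Field K] [AddCommGroup U] [Module K U]
    [AddCommGroup V] [Module K V] {S : Submodule K (U →ₗ[K] V)} (D : Submodule K V)
    (F : S → V) : Prop :=
  ∀ s : S, ¬ D ≤ LinearMap.range (s : U →ₗ[K] V) → F s ∈ LinearMap.range (s : U →ₗ[K] V)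

/-- `F` is *quasi-range-compatible* when it is so with respect to some `1`-dimensional linear
subspace of `V`. -/
def QuasiRangeCompatible {K U V : Type*} [Field K] [AddCommGroup U] [Module K U]
    [AddCommGroup V] [Module K V] {S : Submodule K (U →ₗ[K] V)} (F : S → V) : Prop :=
  ∃ D : Submodule K V, Module.finrank K D = 1 ∧ QuasiRangeCompatibleWrt D F

/-- The linear subspace `S x = {s x | s ∈ S}` of `V`. -/
def evalSpace {K U V : Type*} [Field K] [AddCommGroup U] [Module K U] [AddCommGroup V]
    [Module K V] (S : Submodule K (U →ₗ[K] V)) (x : U) : Submodule K V :=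
  S.map (LinearMap.applyₗ x)

/-- `S` is *special of type `i`* when `dim S x = i` for some `x ∈ U`. -/
def IsSpecialOfType {K U V : Type*} [Field K] [AddCommGroup U] [Module K U] [AddCommGroup V]
    [Module K V] (S : Submodule K (U →ₗ[K] V)) (i : ℕ) : Prop :=
  ∃ x : U, Module.finrank K (evalSpace S x) = i

/-- The codimension of `S` in the space of all linear maps from `U` to `V`. -/
noncomputable def codimOp {K U V : Type*} [Field K] [AddCommGroup U] [Module K U]
    [AddCommGroup V] [Module K V] (S : Submodule K (U →ₗ[K] V)) : ℕ :=
  Module.finrank K ((U →ₗ[K] V) ⧸ S)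

/-- No space of dimension at least `e` over `K` is the union of three lines, in the explicit form in
which this gets used: `3 ≤ e`, or `e = 2` and `K` has more than two elements. -/
def AvoidsThreeLines (K : Type*) [Field K] (e : ℕ) : Prop :=
  3 ≤ e ∨ 2 ≤ e ∧ ∃ α : K, α ≠ 0 ∧ α ≠ 1

section Line

open Module Submodule

variable {K V : Type*} [Field K] [AddCommGroup V] [Module K V]

theorem AvoidsThreeLines.two_le {e : ℕ} (he : AvoidsThreeLines K e) : 2 ≤ e := by
  rcases he with h | h <;> omega

theorem exists_mem_notMem_of_finrank_lt {P Q : Submodule K V} [FiniteDimensional K Q]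
    (h : finrank K Q < finrank K P) : ∃ r ∈ P, r ∉ Q :=
  SetLike.not_le_iff_exists.1 fun hPQ => h.not_ge (finrank_mono hPQ)

theorem finrank_span_singleton_le (a : V) : finrank K (K ∙ a) ≤ 1 := by
  classical
  simpa using finrank_span_le_card (R := K) {a}

theorem finrank_span_pair_le (a b : V) : finrank K (span K {a, b}) ≤ 2 := by
  classical
  exact (finrank_span_le_card (R := K) {a, b}).trans (by simpa using Finset.card_le_two)

theorem finrank_span_triple_le (a b c : V) : finrank K (span K {a, b, c}) ≤ 3 := by
  classical
  exact (finrank_span_le_card (R := K) {a, b, c}).trans (by simpa using Finset.card_le_three)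

theorem linearIndependent_pair_of_notMem_span_singleton {d p : V} (hd : d ≠ 0)
    (hp : p ∉ K ∙ d) : LinearIndependent K ![d, p] :=
  (LinearIndependent.pair_iff' hd).2 fun a ha => hp (mem_span_singleton.2 ⟨a, ha⟩)

theorem notMem_span_singleton_comm {d p : V} (hd : d ≠ 0) (hp : p ∉ K ∙ d) : d ∉ K ∙ p := by
  intro h
  obtain ⟨a, rfl⟩ := mem_span_singleton.1 h
  exact hp (mem_span_singleton.2 ⟨a⁻¹, inv_smul_smul₀ (left_ne_zero_of_smul hd) p⟩)

theorem ne_zero_of_notMem_span_singleton {d p : V} (hp : p ∉ K ∙ d) : p ≠ 0 :=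
  fun h => hp (h ▸ zero_mem _)

section Eigenvector

variable {P : Submodule K V} {g : P →+ V} {d : P}

/-- Compare `g (s • p + d)` with `g (s • p) + g d`. -/
theorem apply_smul_eq_of_eigen_off_line (hd : d ≠ 0)
    (hg : ∀ p : P, (p : V) ∉ K ∙ (d : V) → g p ∈ K ∙ (p : V)) {p : P} (hp : (p : V) ∉ K ∙ (d : V))
    {a b s : K} (hs : s ≠ 0) (hgd : g d = a • (p : V) + b • (d : V)) :
    g (s • p) = (s * b - a) • (p : V) := by
  have hsp : s • (p : V) ∉ K ∙ (d : V) := fun h => hp ((smul_mem_iff _ hs).1 h)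
  obtain ⟨c, hc⟩ := mem_span_singleton.1 (hg (s • p) hsp)
  obtain ⟨r, hr⟩ := mem_span_singleton.1 (hg (s • p + d) fun h =>
    hsp ((add_mem_cancel_right (mem_span_singleton_self (d : V))).1 h))
  rw [map_add, ← hc, hgd] at hr
  push_cast at hr hc
  obtain ⟨hb, ha⟩ := (linearIndependent_pair_of_notMem_span_singleton
    (Submodule.coe_eq_zero.not.2 hd) hp).eq_of_pair
    (s := r) (t := r * s) (s' := b) (t' := c * s + a) (by
      linear_combination (norm := module) hr)
  rw [← hc, smul_smul]
  congr 1
  linear_combination -ha + s * hb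

theorem apply_mem_span_singleton_of_eigen_off_line [FiniteDimensional K V] {e : ℕ}
    (he : AvoidsThreeLines K e) (hP : e ≤ finrank K P) (hd : d ≠ 0)
    (hg : ∀ p : P, (p : V) ∉ K ∙ (d : V) → g p ∈ K ∙ (p : V)) : g d ∈ K ∙ (d : V) := by
  have exists_coeff : ∀ p : P, (p : V) ∉ K ∙ (d : V) →
      ∃ a b : K, g d = a • (p : V) + b • (d : V) := by
    intro p hp
    have hpd : (p : V) + d ∉ K ∙ (d : V) := fun h =>
      hp ((add_mem_cancel_right (mem_span_singleton_self (d : V))).1 h)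
    obtain ⟨c, hc⟩ := mem_span_singleton.1 (hg p hp)
    obtain ⟨r, hr⟩ := mem_span_singleton.1 (hg (p + d) hpd)
    refine ⟨r - c, r, ?_⟩
    rw [map_add, ← hc] at hr
    push_cast at hr
    linear_combination (norm := module) -hr
  obtain ⟨p, hpP, hp⟩ := exists_mem_notMem_of_finrank_lt (P := P) (Q := K ∙ (d : V))
    (by have := finrank_span_singleton_le (K := K) (d : V); have := he.two_le; omega)
  obtain ⟨a, b, hab⟩ := exists_coeff ⟨p, hpP⟩ hp
  rcases he with he | ⟨-, α, hα₀, hα₁⟩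
  · obtain ⟨q, hqP, hq⟩ := exists_mem_notMem_of_finrank_lt (P := P) (Q := span K {p, (d : V)})
      (by have := finrank_span_pair_le (K := K) p (d : V); omega)
    obtain ⟨a', b', hab'⟩ := exists_coeff ⟨q, hqP⟩ fun h => hq (span_mono (by simp) h)
    have ha' : a' = 0 := by
      by_contra ha'
      refine hq ((smul_mem_iff _ ha').1 (mem_span_pair.2 ⟨a, b - b', ?_⟩))
      linear_combination (norm := module) hab' - hab
    exact mem_span_singleton.2 ⟨b', by simp [hab', ha']⟩
  · have key := fun s hs => apply_smul_eq_of_eigen_off_line (s := s) hd hg hp hs hab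
    have hsum : (b - a) • p = (b - 2 * a) • p := calc
      (b - a) • p = g ((α + (1 - α)) • ⟨p, hpP⟩) := by
        rw [add_sub_cancel, key 1 one_ne_zero, one_mul]
      _ = (b - 2 * a) • p := by
        rw [add_smul, map_add, key α hα₀, key (1 - α) (sub_ne_zero.2 hα₁.symm)]
        module
    have ha : a = 0 := by
      linear_combination smul_left_injective K (ne_zero_of_notMem_span_singleton hp) hsum
    exact mem_span_singleton.2 ⟨b, by simp [hab, ha]⟩

theorem exists_eq_smul_of_eigen_off_line_of_mem [FiniteDimensional K V] {e : ℕ}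
    (he : AvoidsThreeLines K e) (hP : e ≤ finrank K P) (hd : d ≠ 0)
    (hg : ∀ p : P, (p : V) ∉ K ∙ (d : V) → g p ∈ K ∙ (p : V)) :
    ∃ b : K, ∀ p : P, g p = b • (p : V) := by
  obtain ⟨b, hb⟩ := mem_span_singleton.1
    (apply_mem_span_singleton_of_eigen_off_line he hP hd hg)
  have off_line : ∀ p : P, (p : V) ∉ K ∙ (d : V) → g p = b • (p : V) := fun p hp => by
    simpa using apply_smul_eq_of_eigen_off_line hd hg hp (a := 0) (b := b) one_ne_zero
      (by rw [zero_smul, zero_add, hb])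
  refine ⟨b, fun p => ?_⟩
  by_cases hp : (p : V) ∈ K ∙ (d : V)
  · obtain ⟨q, hqP, hq⟩ := exists_mem_notMem_of_finrank_lt (P := P) (Q := K ∙ (d : V))
      (by have := finrank_span_singleton_le (K := K) (d : V); have := he.two_le; omega)
    have hpq := off_line (p + ⟨q, hqP⟩) fun h => hq ((add_mem_cancel_left hp).1 h)
    rw [map_add, off_line ⟨q, hqP⟩ hq] at hpq
    simpa using hpq
  · exact off_line p hp

theorem exists_eq_smul_of_eigen_off_line [FiniteDimensional K V] {e : ℕ}
    (he : AvoidsThreeLines K e) (hP : e ≤ finrank K P) (w : V)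
    (hg : ∀ p : P, (p : V) ∉ K ∙ w → g p ∈ K ∙ (p : V)) :
    ∃ b : K, ∀ p : P, g p = b • (p : V) := by
  by_cases hw : w ∈ P ∧ w ≠ 0
  · exact exists_eq_smul_of_eigen_off_line_of_mem (d := ⟨w, hw.1⟩) he hP
      (by simpa using hw.2) hg
  · obtain ⟨d, hdP, hd⟩ := exists_mem_notMem_of_finrank_lt (P := P) (Q := ⊥)
      (by rw [finrank_bot]; have := he.two_le; omega)
    refine exists_eq_smul_of_eigen_off_line_of_mem (d := ⟨d, hdP⟩) he hP
      (by simpa using hd) fun p hp => hg p fun hpw => hw ?_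
    obtain ⟨c, hc⟩ := mem_span_singleton.1 hpw
    have hcw : c • w ≠ 0 := hc ▸ ne_zero_of_notMem_span_singleton hp
    exact ⟨(smul_mem_iff _ (left_ne_zero_of_smul hcw)).1 (hc ▸ p.2), right_ne_zero_of_smul hcw⟩

end Eigenvector

end Line

section DualForms

open Module Submodule

variable {K V : Type*} [Field K] [AddCommGroup V] [Module K V]

theorem exists_add_smul_notMem_union {α : K} (hα₀ : α ≠ 0) (hα₁ : α ≠ 1) {A B : Submodule K V}
    {v : V} (hA : v ∉ A) (hB : v ∉ B) (x : V) : ∃ l : K, x + l • v ∉ A ∧ x + l • v ∉ B := by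
  have unique : ∀ {C : Submodule K V}, v ∉ C → ∀ {l m : K}, l ≠ m →
      x + l • v ∈ C → x + m • v ∉ C := by
    intro C hC l m hlm hl hm
    refine hC ((smul_mem_iff _ (sub_ne_zero.2 hlm)).1 ?_)
    convert sub_mem hl hm using 1
    module
  by_contra! hAB
  have pigeonhole : ∀ l, x + l • v ∈ A ∨ x + l • v ∈ B := fun l => or_iff_not_imp_left.2 (hAB l)
  rcases pigeonhole 0 with h | h
  · exact unique hB hα₁.symm ((pigeonhole 1).resolve_left (unique hA zero_ne_one h))
      ((pigeonhole α).resolve_left (unique hA hα₀.symm h))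
  · exact unique hA hα₁.symm ((pigeonhole 1).resolve_right (unique hB zero_ne_one h))
      ((pigeonhole α).resolve_right (unique hB hα₀.symm h))

theorem le_span_diff_union {α : K} (hα₀ : α ≠ 0) (hα₁ : α ≠ 1) {W A B : Submodule K V}
    {v : V} (hW : v ∈ W) (hA : v ∉ A) (hB : v ∉ B) :
    W ≤ span K ((W : Set V) \ (A ∪ B)) := by
  intro x hx
  obtain ⟨l, hlA, hlB⟩ := exists_add_smul_notMem_union hα₀ hα₁ hA hB x
  have hv : v ∈ span K ((W : Set V) \ (A ∪ B)) := subset_span ⟨hW, by simp [hA, hB]⟩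
  exact (add_mem_cancel_right (smul_mem _ l hv)).1
    (subset_span ⟨add_mem hx (smul_mem _ l hW), by simp [hlA, hlB]⟩)

theorem inf_lt_span_diff_union {W A B : Submodule K V} {v : V} (hW : v ∈ W) (hA : v ∉ A)
    (hB : v ∉ B) : W ⊓ (A ⊓ B) < span K ((W : Set V) \ (A ∪ B)) := by
  have hv : v ∈ span K ((W : Set V) \ (A ∪ B)) := subset_span ⟨hW, by simp [hA, hB]⟩
  refine SetLike.lt_iff_le_and_exists.2 ⟨fun x ⟨hxW, hxA, hxB⟩ => ?_, v, hv, fun h => hA h.2.1⟩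
  refine (add_mem_cancel_right hv).1 (subset_span ⟨add_mem hxW hW, ?_⟩)
  simp [add_mem_cancel_left (S := Submodule K V) hxA,
    add_mem_cancel_left (S := Submodule K V) hxB, hA, hB]

theorem mem_dualAnnihilator_span_singleton {x : V} {φ : Dual K V} :
    φ ∈ (K ∙ x).dualAnnihilator ↔ φ x = 0 := by
  rw [← SetLike.mem_coe, coe_dualAnnihilator_span]
  simp

theorem exists_dual_eq_zero_and_ne_zero {p d w : V} (hd : d ∉ K ∙ p) (hw : w ∉ K ∙ p) :
    ∃ φ : Dual K V, φ p = 0 ∧ φ d ≠ 0 ∧ φ w ≠ 0 := by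
  obtain ⟨φ, hφd, hφ⟩ := exists_le_ker_of_notMem hd
  obtain ⟨ψ, hψw, hψ⟩ := exists_le_ker_of_notMem hw
  have hφp : φ p = 0 := hφ (mem_span_singleton_self p)
  have hψp : ψ p = 0 := hψ (mem_span_singleton_self p)
  by_cases hφw : φ w = 0
  · by_cases hψd : ψ d = 0
    · exact ⟨φ + ψ, by simp [hφp, hψp], by simp [hψd, hφd], by simp [hφw, hψw]⟩
    · exact ⟨ψ, hψp, hψd, hψw⟩
  · exact ⟨φ, hφp, hφd, hφw⟩

theorem finrank_add_one_le_finrank_span_dual_add [FiniteDimensional K V] {e : ℕ}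
    (he : AvoidsThreeLines K e) {p d w : V} (hd : d ∉ K ∙ p) (hw : w ∉ K ∙ p) :
    finrank K V + 1 ≤
      finrank K (span K {φ : Dual K V | φ p = 0 ∧ φ d ≠ 0 ∧ φ w ≠ 0}) + e := by
  have hset : {φ : Dual K V | φ p = 0 ∧ φ d ≠ 0 ∧ φ w ≠ 0} =
      ((K ∙ p).dualAnnihilator : Set (Dual K V)) \
        ((K ∙ d).dualAnnihilator ∪ (K ∙ w).dualAnnihilator) := by
    ext φ
    simp
  obtain ⟨φ, hφp, hφd, hφw⟩ := exists_dual_eq_zero_and_ne_zero hd hw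
  rw [← mem_dualAnnihilator_span_singleton] at hφp
  rw [Ne, ← mem_dualAnnihilator_span_singleton] at hφd hφw
  rw [hset]
  rcases he with he | ⟨he, α, hα₀, hα₁⟩
  · have hlt := finrank_lt_finrank_of_lt (inf_lt_span_diff_union hφp hφd hφw)
    have hinf := Subspace.finrank_add_finrank_dualAnnihilator_eq (span K {p, d, w})
    rw [span_insert, span_insert, dualAnnihilator_sup_eq, dualAnnihilator_sup_eq] at hinf
    have htriple := finrank_span_triple_le (K := K) p d w
    rw [span_insert, span_insert] at htriple
    omega
  · have hle := finrank_mono (le_span_diff_union hα₀ hα₁ hφp hφd hφw)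
    have hp := Subspace.finrank_add_finrank_dualAnnihilator_eq (K ∙ p)
    have hline := finrank_span_singleton_le (K := K) p
    omega

end DualForms

section OperatorSpaces

open Module Submodule

variable {K U V : Type*} [Field K] [AddCommGroup U] [Module K U] [AddCommGroup V] [Module K V]

theorem finrank_quotient_span_singleton_add_one [FiniteDimensional K U] {x : U} (hx : x ≠ 0) :
    finrank K (U ⧸ K ∙ x) + 1 = finrank K U := by
  rw [← finrank_quotient_add_finrank (K ∙ x), finrank_span_singleton hx]

/-- Evaluation at `x` on the operator space `S`; its range is `evalSpace S x`. -/
def evalMap (S : Submodule K (U →ₗ[K] V)) (x : U) : S →ₗ[K] V :=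
  (LinearMap.applyₗ x).domRestrict S

@[simp]
theorem evalMap_apply (S : Submodule K (U →ₗ[K] V)) (x : U) (s : S) :
    evalMap S x s = (s : U →ₗ[K] V) x :=
  rfl

theorem mem_evalSpace {S : Submodule K (U →ₗ[K] V)} {x : U} {v : V} :
    v ∈ evalSpace S x ↔ ∃ s ∈ S, s x = v :=
  Iff.rfl

theorem finrank_evalSpace_zero (S : Submodule K (U →ₗ[K] V)) : finrank K (evalSpace S 0) = 0 := by
  rw [evalSpace, map_zero, Submodule.map_zero, finrank_bot]

theorem range_evalMap (S : Submodule K (U →ₗ[K] V)) (x : U) :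
    LinearMap.range (evalMap S x) = evalSpace S x :=
  LinearMap.range_domRestrict _ _

/-- The operators of `S` that vanish at `x`, seen as operators on `U ⧸ K ∙ x`. -/
def vanishingAt (S : Submodule K (U →ₗ[K] V)) (x : U) : Submodule K ((U ⧸ K ∙ x) →ₗ[K] V) :=
  S.comap (LinearMap.lcomp K V (K ∙ x).mkQ)

theorem mem_vanishingAt {S : Submodule K (U →ₗ[K] V)} {x : U} {s : (U ⧸ K ∙ x) →ₗ[K] V} :
    s ∈ vanishingAt S x ↔ s ∘ₗ (K ∙ x).mkQ ∈ S :=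
  Iff.rfl

theorem mkQ_span_singleton_self (x : U) : (K ∙ x).mkQ x = 0 :=
  (Quotient.mk_eq_zero _).2 (mem_span_singleton_self x)

theorem exists_mem_vanishingAt_comp_mkQ_eq {S : Submodule K (U →ₗ[K] V)} {x : U} {s : U →ₗ[K] V}
    (hs : s ∈ S) (hx : s x = 0) : ∃ s' ∈ vanishingAt S x, s' ∘ₗ (K ∙ x).mkQ = s := by
  have hker : K ∙ x ≤ LinearMap.ker s := (span_singleton_le_iff_mem _ _).2 hx
  exact ⟨(K ∙ x).liftQ s hker, by rwa [mem_vanishingAt, liftQ_mkQ], liftQ_mkQ _ _ hker⟩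

theorem map_lcomp_mkQ_vanishingAt (S : Submodule K (U →ₗ[K] V)) (x : U) :
    (vanishingAt S x).map (LinearMap.lcomp K V (K ∙ x).mkQ) =
      (LinearMap.ker (evalMap S x)).map S.subtype := by
  ext s
  constructor
  · rintro ⟨s', hs', rfl⟩
    exact ⟨⟨_, hs'⟩, (congrArg s' (mkQ_span_singleton_self x)).trans (map_zero s'), rfl⟩
  · rintro ⟨s, hs, rfl⟩
    exact exists_mem_vanishingAt_comp_mkQ_eq s.2 hs

theorem finrank_evalSpace_add_finrank_vanishingAt [FiniteDimensional K U] [FiniteDimensional K V]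
    (S : Submodule K (U →ₗ[K] V)) (x : U) :
    finrank K (evalSpace S x) + finrank K (vanishingAt S x) = finrank K S := by
  have hinj : Function.Injective (LinearMap.lcomp K V (K ∙ x).mkQ) := fun _ _ h =>
    (LinearMap.cancel_right (mkQ_surjective _)).1 h
  rw [← range_evalMap, (equivMapOfInjective _ hinj (vanishingAt S x)).finrank_eq,
    map_lcomp_mkQ_vanishingAt, finrank_map_subtype_eq, LinearMap.finrank_range_add_finrank_ker]

theorem codimOp_add_finrank [FiniteDimensional K U] [FiniteDimensional K V]
    (S : Submodule K (U →ₗ[K] V)) : codimOp S + finrank K S = finrank K U * finrank K V := by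
  rw [codimOp, finrank_quotient_add_finrank, finrank_linearMap]

theorem codimOp_vanishingAt_add_finrank [FiniteDimensional K U] [FiniteDimensional K V]
    (S : Submodule K (U →ₗ[K] V)) {x : U} (hx : x ≠ 0) :
    codimOp (vanishingAt S x) + finrank K V = codimOp S + finrank K (evalSpace S x) := by
  have hS := codimOp_add_finrank S
  have hvanishing := codimOp_add_finrank (vanishingAt S x)
  have hrank := finrank_evalSpace_add_finrank_vanishingAt S x
  rw [← finrank_quotient_span_singleton_add_one (K := K) hx, add_mul, one_mul] at hS
  omega

/-- The operators of `S` composed with the projection of `V` modulo `y`. -/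
def modRange (S : Submodule K (U →ₗ[K] V)) (y : V) : Submodule K (U →ₗ[K] (V ⧸ K ∙ y)) :=
  S.map (LinearMap.compRight K (K ∙ y).mkQ)

theorem mem_modRange {S : Submodule K (U →ₗ[K] V)} {y : V} {s : U →ₗ[K] (V ⧸ K ∙ y)} :
    s ∈ modRange S y ↔ ∃ t ∈ S, (K ∙ y).mkQ ∘ₗ t = s :=
  Iff.rfl

theorem evalSpace_modRange (S : Submodule K (U →ₗ[K] V)) (y : V) (x : U) :
    evalSpace (modRange S y) x = (evalSpace S x).map (K ∙ y).mkQ := by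
  simp only [evalSpace, modRange, ← map_comp]
  rfl

theorem finrank_evalSpace_le_finrank_evalSpace_modRange_add_one [FiniteDimensional K V]
    (S : Submodule K (U →ₗ[K] V)) (y : V) (x : U) :
    finrank K (evalSpace S x) ≤ finrank K (evalSpace (modRange S y) x) + 1 := by
  have hrank := LinearMap.finrank_range_add_finrank_ker ((K ∙ y).mkQ.domRestrict (evalSpace S x))
  rw [LinearMap.range_domRestrict, ← evalSpace_modRange] at hrank
  have hker : (LinearMap.ker ((K ∙ y).mkQ.domRestrict (evalSpace S x))).map (evalSpace S x).subtype
      ≤ K ∙ y := by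
    rintro _ ⟨v, hv, rfl⟩
    exact (Quotient.mk_eq_zero _).1 hv
  have hle := (finrank_mono hker).trans (finrank_span_singleton_le y)
  rw [finrank_map_subtype_eq] at hle
  omega

variable (K U V) in
/-- The trace pairing `(t, s) ↦ tr (s ∘ t)`, as a map to the dual of `U →ₗ[K] V`. -/
noncomputable def traceDual : (V →ₗ[K] U) →ₗ[K] Dual K (U →ₗ[K] V) where
  toFun t := LinearMap.trace K V ∘ₗ LinearMap.lcomp K V t
  map_add' t t' := by ext s; simp [LinearMap.lcomp_apply', LinearMap.comp_add]
  map_smul' a t := by ext s; simp [LinearMap.lcomp_apply', LinearMap.comp_smul]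

theorem traceDual_apply (t : V →ₗ[K] U) (s : U →ₗ[K] V) :
    traceDual K U V t s = LinearMap.trace K V (s ∘ₗ t) :=
  rfl

/-- The orthogonal of `S` for the trace pairing, a space of operators from `V` to `U`. -/
noncomputable def traceOrthogonal (S : Submodule K (U →ₗ[K] V)) : Submodule K (V →ₗ[K] U) :=
  S.dualAnnihilator.comap (traceDual K U V)

theorem mem_traceOrthogonal {S : Submodule K (U →ₗ[K] V)} {t : V →ₗ[K] U} :
    t ∈ traceOrthogonal S ↔ ∀ s ∈ S, LinearMap.trace K V (s ∘ₗ t) = 0 :=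
  mem_dualAnnihilator _

section FiniteDimensional

variable [FiniteDimensional K V]

theorem trace_comp_smulRight (s : U →ₗ[K] V) (φ : Dual K V) (u : U) :
    LinearMap.trace K V (s ∘ₗ φ.smulRight u) = φ (s u) := by
  have hcomp : s ∘ₗ φ.smulRight u = φ.smulRight (s u) := by
    ext v
    simp
  rw [hcomp, LinearMap.trace_smulRight]

theorem smulRight_mem_traceOrthogonal {S : Submodule K (U →ₗ[K] V)} {φ : Dual K V} {u : U} :
    φ.smulRight u ∈ traceOrthogonal S ↔ ∀ s ∈ S, φ (s u) = 0 := by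
  simp only [mem_traceOrthogonal, trace_comp_smulRight]

theorem traceOrthogonal_modRange (S : Submodule K (U →ₗ[K] V)) (y : V) :
    traceOrthogonal (modRange S y) = vanishingAt (traceOrthogonal S) y := by
  ext t
  simp only [mem_traceOrthogonal, mem_vanishingAt, mem_modRange, forall_exists_index, and_imp,
    forall_apply_eq_imp_iff₂]
  refine forall₂_congr fun s _ => ?_
  rw [LinearMap.comp_assoc, LinearMap.trace_comp_comm', LinearMap.comp_assoc]

variable [FiniteDimensional K U]

theorem traceDual_bijective : Function.Bijective (traceDual K U V) := by
  have hinj : Function.Injective (traceDual K U V) := by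
    rw [← LinearMap.ker_eq_bot, LinearMap.ker_eq_bot']
    intro t ht
    ext v
    rw [LinearMap.zero_apply, ← forall_dual_apply_eq_zero_iff K]
    intro f
    have hf := LinearMap.congr_fun ht (f.smulRight v)
    rwa [traceDual_apply, ← LinearMap.trace_comp_comm', trace_comp_smulRight] at hf
  refine ⟨hinj, (LinearMap.injective_iff_surjective_of_finrank_eq_finrank ?_).1 hinj⟩
  rw [Subspace.dual_finrank_eq, finrank_linearMap, finrank_linearMap, mul_comm]

theorem finrank_traceOrthogonal (S : Submodule K (U →ₗ[K] V)) :
    finrank K (traceOrthogonal S) = codimOp S := by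
  rw [codimOp, (Subspace.quotEquivAnnihilator S).finrank_eq,
    ← map_comap_eq_of_surjective (traceDual_bijective (K := K)).surjective S.dualAnnihilator]
  exact (equivMapOfInjective _ traceDual_bijective.injective (traceOrthogonal S)).finrank_eq

theorem traceOrthogonal_traceOrthogonal (S : Submodule K (U →ₗ[K] V)) :
    traceOrthogonal (traceOrthogonal S) = S := by
  refine (eq_of_le_of_finrank_eq (fun s hs => mem_traceOrthogonal.2 fun t ht => ?_) ?_).symm
  · rw [LinearMap.trace_comp_comm']
    exact mem_traceOrthogonal.1 ht s hs
  · have hS := codimOp_add_finrank S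
    have hST := codimOp_add_finrank (traceOrthogonal S)
    rw [finrank_traceOrthogonal, mul_comm] at hST
    rw [finrank_traceOrthogonal]
    omega

theorem codimOp_modRange_add_finrank (S : Submodule K (U →ₗ[K] V)) (y : V) :
    codimOp (modRange S y) + finrank K (evalSpace (traceOrthogonal S) y) = codimOp S := by
  rw [← finrank_traceOrthogonal, traceOrthogonal_modRange, add_comm,
    finrank_evalSpace_add_finrank_vanishingAt, finrank_traceOrthogonal]

theorem finrank_span_le_codimOp (S : Submodule K (U →ₗ[K] V)) {Φ : Set (Dual K V)}
    (hΦ : ∀ φ ∈ Φ, ∃ u ≠ 0, ∀ s ∈ S, φ (s u) = 0) : finrank K (span K Φ) ≤ codimOp S := by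
  obtain ⟨b, hbΦ, hspan, hb⟩ := exists_linearIndependent K Φ
  have : Fintype b := hb.setFinite.fintype
  choose u hu₀ hu using fun φ : b => hΦ φ (hbΦ φ.2)
  have hli : LinearIndependent K fun φ : b => (φ : Dual K V).smulRight (u φ) := by
    rw [Fintype.linearIndependent_iff]
    intro a ha φ
    obtain ⟨f, hf⟩ : ∃ f : Dual K U, f (u φ) ≠ 0 := by
      by_contra! h
      exact hu₀ φ ((forall_dual_apply_eq_zero_iff K _).1 h)
    have hsum : ∑ ψ : b, (a ψ * f (u ψ)) • (ψ : Dual K V) = 0 := by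
      ext v
      simpa [mul_assoc, mul_comm, mul_left_comm] using congrArg f (LinearMap.congr_fun ha v)
    exact (mul_eq_zero.1 (Fintype.linearIndependent_iff.1 hb _ hsum φ)).resolve_right hf
  have hle : span K (Set.range fun φ : b => (φ : Dual K V).smulRight (u φ)) ≤ traceOrthogonal S :=
    span_le.2 (Set.range_subset_iff.2 fun φ => smulRight_mem_traceOrthogonal.2 (hu φ))
  calc finrank K (span K Φ) = Fintype.card b := by
        rw [← hspan, finrank_span_set_eq_card hb, Set.toFinset_card]
    _ = finrank K (span K (Set.range fun φ : b => (φ : Dual K V).smulRight (u φ))) :=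
        (finrank_span_eq_card hli).symm
    _ ≤ codimOp S := finrank_traceOrthogonal S ▸ finrank_mono hle

theorem exists_comp_surjective_of_codimOp_lt (S : Submodule K (U →ₗ[K] V)) {Φ : Set (Dual K V)}
    (hΦ : codimOp S < finrank K (span K Φ)) :
    ∃ φ ∈ Φ, ∀ f : Dual K U, ∃ s ∈ S, φ ∘ₗ s = f := by
  by_contra! h
  refine hΦ.not_ge (finrank_span_le_codimOp S fun φ hφ => ?_)
  obtain ⟨f, hf⟩ := h φ hφ
  let W : Subspace K (Dual K U) := S.map (LinearMap.compRight K φ)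
  have hW : W.dualCoannihilator ≠ ⊥ := by
    intro hW
    have htop : W = ⊤ := by
      rw [← Subspace.dualCoannihilator_dualAnnihilator_eq (W := W), hW, dualAnnihilator_bot]
    obtain ⟨s, hs, hsf⟩ := htop ▸ mem_top (x := f)
    exact hf s hs hsf
  obtain ⟨u, hu, hu₀⟩ := exists_mem_ne_zero_of_ne_bot hW
  exact ⟨u, hu₀, fun s hs => (mem_dualCoannihilator _).1 hu _ (mem_map_of_mem hs)⟩

theorem exists_mem_apply_eq_and_comp_eq_zero (S : Submodule K (U →ₗ[K] V)) {x : U} {p : V}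
    (hp : p ∈ evalSpace S x) {Φ : Set (Dual K V)} (hΦp : ∀ φ ∈ Φ, φ p = 0)
    (hΦ : codimOp (vanishingAt S x) < finrank K (span K Φ)) :
    ∃ φ ∈ Φ, ∃ s ∈ S, s x = p ∧ φ ∘ₗ s = 0 := by
  obtain ⟨φ, hφ, hsurj⟩ := exists_comp_surjective_of_codimOp_lt _ hΦ
  obtain ⟨s, hs, rfl⟩ := mem_evalSpace.1 hp
  have hker : K ∙ x ≤ LinearMap.ker (φ ∘ₗ s) :=
    (span_singleton_le_iff_mem _ _).2 (hΦp φ hφ)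
  obtain ⟨s', hs', hφs'⟩ := hsurj ((K ∙ x).liftQ (φ ∘ₗ s) hker)
  refine ⟨φ, hφ, s - s' ∘ₗ (K ∙ x).mkQ, sub_mem hs hs', ?_, ?_⟩
  · rw [LinearMap.sub_apply, LinearMap.comp_apply, mkQ_span_singleton_self, map_zero, sub_zero]
  · rw [LinearMap.comp_sub, ← LinearMap.comp_assoc, hφs', liftQ_mkQ, sub_self]

end FiniteDimensional

end OperatorSpaces

section ReductionAtVector

open Module Submodule

variable {K U V : Type*} [Field K] [AddCommGroup U] [Module K U] [AddCommGroup V] [Module K V]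
  {S : Submodule K (U →ₗ[K] V)}

theorem quasiRangeCompatibleWrt_span_singleton_iff {d : V} {F : S → V} :
    QuasiRangeCompatibleWrt (K ∙ d) F ↔
      ∀ s : S, d ∉ LinearMap.range (s : U →ₗ[K] V) → F s ∈ LinearMap.range (s : U →ₗ[K] V) := by
  simp only [QuasiRangeCompatibleWrt, span_singleton_le_iff_mem]

theorem QuasiRangeCompatible.exists_span_singleton {F : S → V} (hF : QuasiRangeCompatible F) :
    ∃ d : V, d ≠ 0 ∧ QuasiRangeCompatibleWrt (K ∙ d) F := by
  obtain ⟨D, hD, hF⟩ := hF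
  obtain ⟨⟨d, hdD⟩, hd, -⟩ := finrank_eq_one_iff'.1 hD
  rw [Ne, mk_eq_zero] at hd
  exact ⟨d, hd, eq_span_singleton_of_mem_of_finrank_eq_one hD hdD hd ▸ hF⟩

theorem QuasiRangeCompatibleWrt.sub_evalMap {D : Submodule K V} {F : S →+ V}
    (hF : QuasiRangeCompatibleWrt D F) (x : U) :
    QuasiRangeCompatibleWrt D (F - (evalMap S x).toAddMonoidHom) :=
  fun s hs => sub_mem (hF s hs) (LinearMap.mem_range_self _ x)

theorem IsLocalMap.of_sub_evalMap {F : S →+ V} {x : U}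
    (hF : IsLocalMap (F - (evalMap S x).toAddMonoidHom)) : IsLocalMap F := by
  obtain ⟨y, hy⟩ := hF
  exact ⟨y + x, fun s => by simpa using sub_eq_iff_eq_add.1 (hy s)⟩

theorem exists_apply_eq_comp_evalMap {x : U} {F : S →+ V}
    (hF : ∀ s, evalMap S x s = 0 → F s = 0) :
    ∃ g : evalSpace S x →+ V, ∀ s : S,
      F s = g ⟨evalMap S x s, mem_map_of_mem s.2⟩ := by
  let E : S →+ evalSpace S x :=
    ((evalMap S x).codRestrict (evalSpace S x) fun s => mem_map_of_mem s.2).toAddMonoidHom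
  have hE : Function.Surjective E := by
    rintro ⟨_, s, hs, rfl⟩
    exact ⟨⟨s, hs⟩, rfl⟩
  have hker : E.ker ≤ F.ker := fun s hs => hF s (congrArg Subtype.val hs)
  exact ⟨E.liftOfSurjective hE ⟨F, hker⟩, fun s =>
    (E.liftOfRightInverse_comp_apply _ _ ⟨F, hker⟩ s).symm⟩

variable [FiniteDimensional K U] [FiniteDimensional K V] {e : ℕ} {d : V} {F : S →+ V} {x : U}

theorem isLocalMap_of_eq_zero_of_evalMap_eq_zero (he : AvoidsThreeLines K e) (hd : d ≠ 0)
    (hF : QuasiRangeCompatibleWrt (K ∙ d) F) (hx : e ≤ finrank K (evalSpace S x))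
    (hc : codimOp (vanishingAt S x) + e ≤ finrank K V)
    (hF₀ : ∀ s, evalMap S x s = 0 → F s = 0) : IsLocalMap F := by
  rw [quasiRangeCompatibleWrt_span_singleton_iff] at hF
  obtain ⟨g, hg⟩ := exists_apply_eq_comp_evalMap hF₀
  have eigen : ∀ p : evalSpace S x, (p : V) ∉ K ∙ d → g p ∈ K ∙ (p : V) := by
    intro p hp
    by_contra hgp
    have hspan := finrank_add_one_le_finrank_span_dual_add he
      (notMem_span_singleton_comm hd hp) hgp
    obtain ⟨φ, ⟨-, hφd, hφg⟩, s, hs, hsx, hφs⟩ :=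
      exists_mem_apply_eq_and_comp_eq_zero S p.2 (Φ := {φ | φ p = 0 ∧ φ d ≠ 0 ∧ φ (g p) ≠ 0})
        (fun φ hφ => hφ.1) (by omega)
    have hφ : ∀ v ∈ LinearMap.range s, φ v = 0 := by
      rintro _ ⟨u, rfl⟩
      exact LinearMap.congr_fun hφs u
    have hgs : F ⟨s, hs⟩ = g p := by simpa [hsx] using hg ⟨s, hs⟩
    exact hφg (hφ _ (hgs ▸ hF ⟨s, hs⟩ fun h => hφd (hφ d h)))
  obtain ⟨l, hl⟩ := exists_eq_smul_of_eigen_off_line he hx d eigen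
  exact ⟨l • x, fun s => by simp [hg s, hl]⟩

theorem isLocalMap_of_vanishingAt (he : AvoidsThreeLines K e) (hd : d ≠ 0)
    (hF : QuasiRangeCompatibleWrt (K ∙ d) F)
    (hx : finrank K (evalSpace S x) = 0 ∨ e ≤ finrank K (evalSpace S x))
    (hc : codimOp (vanishingAt S x) + e ≤ finrank K V)
    (hlocal : ∀ G : vanishingAt S x →+ V, QuasiRangeCompatibleWrt (K ∙ d) G → IsLocalMap G) :
    IsLocalMap F := by
  let lift : vanishingAt S x →ₗ[K] S :=
    (LinearMap.lcomp K V (K ∙ x).mkQ).restrict fun _ hs => hs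
  have range_lift : ∀ s, LinearMap.range (lift s : U →ₗ[K] V) =
      LinearMap.range (s : (U ⧸ K ∙ x) →ₗ[K] V) := fun s =>
    LinearMap.range_comp_of_range_eq_top _ (range_mkQ _)
  obtain ⟨z, hz⟩ := hlocal (F.comp lift.toAddMonoidHom) fun s hs => by
    have hFs := hF (lift s)
    rw [range_lift] at hFs
    exact hFs hs
  obtain ⟨z, rfl⟩ := mkQ_surjective _ z
  have hF₀ : ∀ s, evalMap S x s = 0 → (F - (evalMap S z).toAddMonoidHom) s = 0 := by
    intro s hs
    obtain ⟨s', hs', hlift⟩ := exists_mem_vanishingAt_comp_mkQ_eq s.2 hs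
    obtain rfl : lift ⟨s', hs'⟩ = s := Subtype.ext hlift
    exact sub_eq_zero.2 (hz ⟨s', hs'⟩)
  refine IsLocalMap.of_sub_evalMap (x := z) ?_
  rcases hx with hx | hx
  · refine ⟨0, fun s => ?_⟩
    rw [map_zero]
    refine hF₀ s ((mem_bot K).1 ?_)
    rw [← finrank_eq_zero.1 hx]
    exact mem_map_of_mem s.2
  · exact isLocalMap_of_eq_zero_of_evalMap_eq_zero he hd (hF.sub_evalMap z) hx hc hF₀

theorem isLocalMap_of_codimOp_add_le (he : AvoidsThreeLines K e) (hd : d ≠ 0)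
    (hF : QuasiRangeCompatibleWrt (K ∙ d) F) (hc : codimOp S + e ≤ finrank K V) :
    IsLocalMap F := by
  induction hm : finrank K U generalizing U with
  | zero =>
    have : Subsingleton U := finrank_zero_iff.1 hm
    refine ⟨0, fun s => ?_⟩
    rw [Subsingleton.elim s 0, map_zero]
    rfl
  | succ m ih =>
    have : Nontrivial U := nontrivial_of_finrank_pos (R := K) (by omega)
    obtain ⟨x, hx⟩ := exists_ne (0 : U)
    have hcodim := codimOp_vanishingAt_add_finrank S hx
    have hquotient := finrank_quotient_span_singleton_add_one (K := K) hx
    have hle := Submodule.finrank_le (evalSpace S x)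
    exact isLocalMap_of_vanishingAt he hd hF (x := x) (.inr (by omega)) (by omega)
      fun G hG => ih hG (by omega) (by omega)

end ReductionAtVector

section RankOneValues

open Module Submodule

variable {K U V : Type*} [Field K] [AddCommGroup U] [Module K U] [AddCommGroup V] [Module K V]

theorem eq_span_singleton_of_finrank_le_one {P : Submodule K V} [FiniteDimensional K P]
    (hP : finrank K P ≤ 1) {v : V} (hv : v ∈ P) (hv₀ : v ≠ 0) : P = K ∙ v := by
  refine (eq_of_le_of_finrank_le ((span_singleton_le_iff_mem _ _).2 hv) ?_).symm
  rwa [finrank_span_singleton hv₀]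

variable [FiniteDimensional K U] {T : Submodule K (V →ₗ[K] U)}

/-- Subtracting a multiple of `t` from an operator not vanishing at `y` makes it vanish at `z`;
evaluate both operators at `y + z`. -/
theorem evalSpace_eq_of_finrank_evalSpace_le_one (hT : ∀ y, finrank K (evalSpace T y) ≤ 1) {y z : V}
    (hy : evalSpace T y ≠ ⊥) {t : V →ₗ[K] U} (ht : t ∈ T) (hty : t y = 0) (htz : t z ≠ 0) :
    evalSpace T y = evalSpace T z := by
  have eq_span : ∀ {w : V} {r : V →ₗ[K] U}, r ∈ T → r w ≠ 0 → evalSpace T w = K ∙ r w :=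
    fun hr hrw => eq_span_singleton_of_finrank_le_one (hT _) (mem_map_of_mem hr) hrw
  obtain ⟨_, ⟨r, hr, rfl⟩, hry⟩ := exists_mem_ne_zero_of_ne_bot hy
  rw [LinearMap.applyₗ_apply_apply] at hry
  obtain ⟨c, hc⟩ : ∃ c : K, c • t z = r z :=
    mem_span_singleton.1 (eq_span ht htz ▸ mem_evalSpace.2 ⟨r, hr, rfl⟩)
  have hrt : (r - c • t) (y + z) = r y := by simp [hty, hc]
  have htyz : t (y + z) = t z := by simp [hty]
  calc evalSpace T y = K ∙ r y := eq_span hr hry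
    _ = evalSpace T (y + z) := by
      rw [eq_span (sub_mem hr (smul_mem _ c ht)) (hrt ▸ hry), hrt]
    _ = K ∙ t z := by rw [eq_span ht (htyz ▸ htz), htyz]
    _ = evalSpace T z := (eq_span ht htz).symm

theorem finrank_le_one_or_forall_evalSpace_le_span [FiniteDimensional K V]
    (hT : ∀ y, finrank K (evalSpace T y) ≤ 1) :
    finrank K T ≤ 1 ∨ ∃ u, ∀ w, evalSpace T w ≤ K ∙ u := by
  rw [or_iff_not_imp_left, not_le]
  intro hrank
  by_cases hbot : ∀ y, evalSpace T y = ⊥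
  · exact ⟨0, fun w => (hbot w).trans_le bot_le⟩
  push Not at hbot
  obtain ⟨y, hy⟩ := hbot
  obtain ⟨t, hty, ht⟩ : ∃ t ∈ LinearMap.ker (evalMap T y), t ≠ 0 := by
    refine exists_mem_ne_zero_of_ne_bot fun hker => ?_
    have := LinearMap.finrank_range_add_finrank_ker (evalMap T y)
    rw [range_evalMap, hker, finrank_bot] at this
    have := hT y
    omega
  obtain ⟨z, htz⟩ : ∃ z, (t : V →ₗ[K] U) z ≠ 0 := by
    by_contra! h
    exact ht (Subtype.ext (LinearMap.ext h))
  have hyz := evalSpace_eq_of_finrank_evalSpace_le_one hT hy t.2 hty htz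
  refine ⟨(t : V →ₗ[K] U) z, fun w => ?_⟩
  have hz : evalSpace T z = K ∙ (t : V →ₗ[K] U) z :=
    eq_span_singleton_of_finrank_le_one (hT z) (mem_map_of_mem t.2) htz
  rw [← hz]
  by_cases hw : evalSpace T w = ⊥
  · exact hw.trans_le bot_le
  by_cases htw : (t : V →ₗ[K] U) w = 0
  · exact (evalSpace_eq_of_finrank_evalSpace_le_one hT hw t.2 htw htz).le
  · exact hyz ▸ (evalSpace_eq_of_finrank_evalSpace_le_one hT hy t.2 hty htw).ge

variable [FiniteDimensional K V]

theorem codimOp_le_one_or_exists_finrank_evalSpace (S : Submodule K (U →ₗ[K] V))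
    (hS : ∀ y, finrank K (evalSpace (traceOrthogonal S) y) ≤ 1) :
    codimOp S ≤ 1 ∨ ∃ u ≠ 0, codimOp S + finrank K (evalSpace S u) = finrank K V := by
  have hcodim := finrank_traceOrthogonal S
  rcases finrank_le_one_or_forall_evalSpace_le_span hS with h | ⟨u, hu⟩
  · exact .inl (hcodim ▸ h)
  rcases eq_or_ne u 0 with rfl | hu₀
  · have hbot : traceOrthogonal S = ⊥ := eq_bot_iff.2 fun t ht => LinearMap.ext fun w =>
      by simpa using hu w (mem_map_of_mem ht)
    rw [hbot, finrank_bot] at hcodim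
    exact .inl (by omega)
  · have hmod : modRange (traceOrthogonal S) u = ⊥ := by
      rw [eq_bot_iff]
      rintro _ ⟨t, ht, rfl⟩
      exact LinearMap.ext fun w => (Quotient.mk_eq_zero _).2 (hu w (mem_map_of_mem ht))
    have hS := codimOp_add_finrank (traceOrthogonal S)
    have hquotient := codimOp_add_finrank (modRange (traceOrthogonal S) u)
    have hu := codimOp_modRange_add_finrank (traceOrthogonal S) u
    rw [traceOrthogonal_traceOrthogonal] at hu
    rw [hmod, finrank_bot] at hquotient
    rw [hmod] at hu
    rw [← finrank_quotient_span_singleton_add_one (K := K) hu₀, mul_add, mul_one] at hS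
    exact .inr ⟨u, hu₀, by omega⟩

end RankOneValues

section QuadraticForms

open Module Submodule

variable {K U V : Type*} [Field K] [AddCommGroup U] [Module K U] [AddCommGroup V] [Module K V]

/-- The `2 × 2` minor of the values at a vector of two operators, cut out by the linear forms `f`
and `g`. -/
def minorForm (t₁ t₂ : V →ₗ[K] U) (f g : Dual K U) : QuadraticForm K V :=
  QuadraticMap.linMulLin (f ∘ₗ t₁) (g ∘ₗ t₂) - QuadraticMap.linMulLin (g ∘ₗ t₁) (f ∘ₗ t₂)

theorem minorForm_apply (t₁ t₂ : V →ₗ[K] U) (f g : Dual K U) (v : V) :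
    minorForm t₁ t₂ f g v = f (t₁ v) * g (t₂ v) - g (t₁ v) * f (t₂ v) :=
  rfl

theorem two_le_finrank_evalSpace_iff [FiniteDimensional K U] {T : Submodule K (V →ₗ[K] U)} {v : V} :
    2 ≤ finrank K (evalSpace T v) ↔ ∃ t₁ ∈ T, ∃ t₂ ∈ T, ∃ f g, minorForm t₁ t₂ f g v ≠ 0 := by
  constructor
  · intro h
    obtain ⟨_, ⟨t₁, ht₁, rfl⟩, h₁⟩ := exists_mem_notMem_of_finrank_lt (P := evalSpace T v) (Q := ⊥)
      (by rw [finrank_bot]; omega)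
    obtain ⟨_, ⟨t₂, ht₂, rfl⟩, h₂⟩ := exists_mem_notMem_of_finrank_lt (P := evalSpace T v)
      (Q := K ∙ t₁ v) (by have := finrank_span_singleton_le (K := K) (t₁ v); omega)
    obtain ⟨f, hf, hft₂⟩ := exists_le_ker_of_notMem (notMem_span_singleton_comm h₁ h₂)
    obtain ⟨g, hg, -⟩ := exists_le_ker_of_notMem h₂
    have hft₂ : f (t₂ v) = 0 := hft₂ (mem_span_singleton_self _)
    refine ⟨t₁, ht₁, t₂, ht₂, f, g, ?_⟩
    rw [minorForm_apply, hft₂, mul_zero, sub_zero]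
    exact mul_ne_zero hf hg
  · rintro ⟨t₁, ht₁, t₂, ht₂, f, g, h⟩
    by_contra! hlt
    obtain ⟨w, hw⟩ := finrank_le_one_iff.1 (show finrank K (evalSpace T v) ≤ 1 by omega)
    have value : ∀ t ∈ T, ∃ c : K, c • (w : U) = t v := fun t ht =>
      (hw ⟨t v, mem_map_of_mem ht⟩).imp fun _ => congrArg Subtype.val
    obtain ⟨c₁, h₁⟩ := value t₁ ht₁
    obtain ⟨c₂, h₂⟩ := value t₂ ht₂
    refine h ?_
    rw [minorForm_apply, ← h₁, ← h₂]
    simp only [map_smul, smul_eq_mul]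
    ring

variable [FiniteDimensional K V] {e : ℕ}

theorem exists_finrank_span_triple_lt (he : AvoidsThreeLines K e) (hV : e < finrank K V)
    {a : V} (ha : a ≠ 0) (d : V) :
    ∃ b, b ∉ K ∙ a ∧ b ∉ K ∙ d ∧ a + b ∉ K ∙ d ∧ finrank K (span K {a, d, b}) < finrank K V := by
  rcases he with he | ⟨he, α, hα₀, hα₁⟩
  · obtain ⟨b, -, hb⟩ := exists_mem_notMem_of_finrank_lt (P := ⊤) (Q := span K {a, d})
      (by rw [finrank_top]; have := finrank_span_pair_le (K := K) a d; omega)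
    have ha : a ∈ span K {a, d} := subset_span (by simp)
    have hd : K ∙ d ≤ span K {a, d} := span_mono (by simp)
    exact ⟨b, fun h => hb (span_mono (by simp) h), fun h => hb (hd h),
      fun h => hb ((add_mem_cancel_left ha).1 (hd h)),
      (finrank_span_triple_le a d b).trans_lt (by omega)⟩
  by_cases hd : d ∈ K ∙ a
  · obtain ⟨b, -, hb⟩ := exists_mem_notMem_of_finrank_lt (P := ⊤) (Q := K ∙ a)
      (by rw [finrank_top]; have := finrank_span_singleton_le (K := K) a; omega)
    have hle : K ∙ d ≤ K ∙ a := (span_singleton_le_iff_mem _ _).2 hd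
    have hspan : span K {a, d, b} = span K {a, b} := by
      rw [Set.insert_comm, span_insert_eq_span (span_mono (by simp) hd)]
    exact ⟨b, hb, fun h => hb (hle h),
      fun h => hb ((add_mem_cancel_left (mem_span_singleton_self a)).1 (hle h)),
      hspan ▸ (finrank_span_pair_le a b).trans_lt (by omega)⟩
  · have had : a ∉ K ∙ d := notMem_span_singleton_comm ha hd
    have hab : a + α • (d - a) = (1 - α) • a + α • d := by module
    have hspan : span K {a, d, α • (d - a)} = span K {a, d} := by
      rw [Set.pair_comm, Set.insert_comm, span_insert_eq_span]
      exact smul_mem _ _ (sub_mem (subset_span (by simp)) (subset_span (by simp)))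
    refine ⟨α • (d - a), fun h => hd ?_, fun h => had ?_, fun h => had ?_,
      hspan ▸ (finrank_span_pair_le a d).trans_lt (by omega)⟩
    · simpa using add_mem ((smul_mem_iff _ hα₀).1 h) (mem_span_singleton_self a)
    · simpa using sub_mem (mem_span_singleton_self d) ((smul_mem_iff _ hα₀).1 h)
    · rw [hab, add_mem_cancel_right (smul_mem _ _ (mem_span_singleton_self d))] at h
      exact (smul_mem_iff _ (sub_ne_zero.2 hα₁.symm)).1 h

theorem exists_quadraticForm_ne_zero_notMem (he : AvoidsThreeLines K e) (hV : e < finrank K V)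
    {Q : QuadraticForm K V} {a : V} (ha : Q a ≠ 0) (d : V) :
    ∃ z, Q z ≠ 0 ∧ z ∉ K ∙ a ∧ z ∉ K ∙ d := by
  have ha₀ : a ≠ 0 := fun h => ha (h ▸ Q.map_zero)
  obtain ⟨b, hba, hbd, habd, hlt⟩ := exists_finrank_span_triple_lt he hV ha₀ d
  obtain ⟨c, -, hc⟩ := exists_mem_notMem_of_finrank_lt (P := ⊤) (Q := span K {a, d, b})
    (by rwa [finrank_top])
  have ha_mem : a ∈ span K {a, d, b} := subset_span (by simp)
  have hb_mem : b ∈ span K {a, d, b} := subset_span (by simp)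
  have off_lines : ∀ w, w ∉ span K {a, d, b} → w ∉ K ∙ a ∧ w ∉ K ∙ d := fun w hw =>
    ⟨fun h => hw (span_mono (by simp) h), fun h => hw (span_mono (by simp) h)⟩
  by_contra! h
  have vanish : ∀ w, w ∉ K ∙ a ∧ w ∉ K ∙ d → Q w = 0 := fun w hw => by
    by_contra hQ
    exact hw.2 (h w hQ hw.1)
  have polarization := Q.map_add_add_add_map a b c
  rw [vanish b ⟨hba, hbd⟩, vanish c (off_lines c hc),
    vanish (a + b) ⟨fun h => hba ((add_mem_cancel_left (mem_span_singleton_self a)).1 h), habd⟩,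
    vanish (b + c) (off_lines _ fun h => hc ((add_mem_cancel_left hb_mem).1 h)),
    vanish (c + a) (off_lines _ fun h => hc ((add_mem_cancel_right ha_mem).1 h)),
    vanish (a + b + c) (off_lines _ fun h =>
      hc ((add_mem_cancel_left (add_mem ha_mem hb_mem)).1 h))] at polarization
  exact ha (by simpa using polarization)

theorem exists_two_le_finrank_evalSpace_notMem [FiniteDimensional K U] (he : AvoidsThreeLines K e)
    (hV : e < finrank K V) {T : Submodule K (V →ₗ[K] U)} {a : V}
    (ha : 2 ≤ finrank K (evalSpace T a)) (d : V) :
    ∃ z, 2 ≤ finrank K (evalSpace T z) ∧ z ∉ K ∙ a ∧ z ∉ K ∙ d := by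
  obtain ⟨t₁, ht₁, t₂, ht₂, f, g, hQ⟩ := two_le_finrank_evalSpace_iff.1 ha
  obtain ⟨z, hz, hza, hzd⟩ := exists_quadraticForm_ne_zero_notMem he hV hQ d
  exact ⟨z, two_le_finrank_evalSpace_iff.2 ⟨t₁, ht₁, t₂, ht₂, f, g, hz⟩, hza, hzd⟩

end QuadraticForms

section ReductionModuloVector

open Module Submodule

variable {K U V : Type*} [Field K] [AddCommGroup U] [Module K U] [AddCommGroup V] [Module K V]
  {S : Submodule K (U →ₗ[K] V)} {d y z : V} {F : S →+ V}

theorem exists_modRange_apply_eq_mkQ (hdy : d ∉ K ∙ y) (hF : QuasiRangeCompatibleWrt (K ∙ d) F) :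
    ∃ G : modRange S y →+ V ⧸ K ∙ y, ∀ s : S,
      G ⟨(K ∙ y).mkQ ∘ₗ s, mem_map_of_mem s.2⟩ = (K ∙ y).mkQ (F s) := by
  rw [quasiRangeCompatibleWrt_span_singleton_iff] at hF
  let p : S →+ modRange S y := ((LinearMap.compRight K (K ∙ y).mkQ).submoduleMap S).toAddMonoidHom
  have hp : Function.Surjective p := LinearMap.submoduleMap_surjective _ S
  have hker : p.ker ≤ ((K ∙ y).mkQ.toAddMonoidHom.comp F).ker := by
    intro s hs
    have hrange : LinearMap.range (s : U →ₗ[K] V) ≤ K ∙ y := by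
      rintro _ ⟨u, rfl⟩
      exact (Quotient.mk_eq_zero _).1 (LinearMap.congr_fun (congrArg Subtype.val hs) u)
    exact (Quotient.mk_eq_zero _).2 (hrange (hF s fun h => hdy (hrange h)))
  exact ⟨p.liftOfSurjective hp ⟨_, hker⟩, fun s =>
    p.liftOfRightInverse_comp_apply _ _ ⟨_, hker⟩ s⟩

theorem exists_sub_mem_span_of_modRange (hdy : d ∉ K ∙ y) (hF : QuasiRangeCompatibleWrt (K ∙ d) F)
    (hlocal : ∀ G : modRange S y →+ V ⧸ K ∙ y,
      QuasiRangeCompatibleWrt (K ∙ (K ∙ y).mkQ d) G → IsLocalMap G) :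
    ∃ x : U, ∀ s : S, F s - (s : U →ₗ[K] V) x ∈ K ∙ y := by
  obtain ⟨G, hG⟩ := exists_modRange_apply_eq_mkQ hdy hF
  rw [quasiRangeCompatibleWrt_span_singleton_iff] at hF
  obtain ⟨x, hx⟩ := hlocal G <| by
    rw [quasiRangeCompatibleWrt_span_singleton_iff]
    rintro ⟨_, s, hs, rfl⟩ hds
    obtain ⟨u, hu⟩ := hF ⟨s, hs⟩ fun ⟨u, hu⟩ => hds ⟨u, congrArg (K ∙ y).mkQ hu⟩
    exact ⟨u, (congrArg (K ∙ y).mkQ hu).trans (hG ⟨s, hs⟩).symm⟩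
  exact ⟨x, fun s => (Submodule.Quotient.eq _).1 ((hG s).symm.trans (hx _))⟩

theorem isLocalMap_of_sub_mem_span_singletons (hzy : z ∉ K ∙ y)
    (hS : ∀ x ≠ 0, 2 < finrank K (evalSpace S x))
    (hy : ∃ x : U, ∀ s : S, F s - (s : U →ₗ[K] V) x ∈ K ∙ y)
    (hz : ∃ x : U, ∀ s : S, F s - (s : U →ₗ[K] V) x ∈ K ∙ z) : IsLocalMap F := by
  obtain ⟨x, hx⟩ := hy
  obtain ⟨x', hx'⟩ := hz
  have hle : evalSpace S (x - x') ≤ span K {y, z} := by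
    rintro _ ⟨s, hs, rfl⟩
    have hsub := sub_mem (mem_sup_right (hx' ⟨s, hs⟩)) (mem_sup_left (hx ⟨s, hs⟩))
    rw [sub_sub_sub_cancel_left, ← map_sub] at hsub
    rwa [span_insert]
  obtain rfl : x = x' := by
    by_contra hne
    have : FiniteDimensional K (span K {y, z}) := .span_of_finite K (Set.toFinite _)
    exact (hS _ (sub_ne_zero.2 hne)).not_ge ((finrank_mono hle).trans (finrank_span_pair_le y z))
  have hdisjoint := (disjoint_span_singleton' (ne_zero_of_notMem_span_singleton hzy)).2 hzy
  exact ⟨x, fun s => sub_eq_zero.1 (disjoint_def.1 hdisjoint _ (hx s) (hx' s))⟩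

end ReductionModuloVector

section Induction

open Module Submodule

variable {K U V : Type*} [Field K] [AddCommGroup U] [Module K U] [FiniteDimensional K U]
  [AddCommGroup V] [Module K V] [FiniteDimensional K V] {e : ℕ} {S : Submodule K (U →ₗ[K] V)}
  {d : V} {F : S →+ V}

theorem isLocalMap_of_finrank_evalSpace_le (he : AvoidsThreeLines K e)
    (hS : ∀ i, 0 < i → i < e → ¬ IsSpecialOfType S i) (hc : codimOp S + 2 * e ≤ 2 * finrank K V)
    (hd : d ≠ 0) (hF : QuasiRangeCompatibleWrt (K ∙ d) F) {x : U} (hx : x ≠ 0)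
    (hxe : finrank K (evalSpace S x) ≤ e) : IsLocalMap F := by
  have hcodim := codimOp_vanishingAt_add_finrank S hx
  have hdim : finrank K (evalSpace S x) = 0 ∨ e ≤ finrank K (evalSpace S x) := by
    by_contra! h
    exact hS _ (Nat.pos_of_ne_zero h.1) h.2 ⟨x, rfl⟩
  exact isLocalMap_of_vanishingAt he hd hF hdim (by omega)
    fun G hG => isLocalMap_of_codimOp_add_le he hd hG (by omega)

theorem exists_two_le_finrank_evalSpace_traceOrthogonal (he : AvoidsThreeLines K e)
    (hc : finrank K V < codimOp S + e) (heV : e < finrank K V)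
    (hS : ∀ x ≠ 0, e < finrank K (evalSpace S x)) (hd : d ≠ 0) :
    ∃ y z, d ∉ K ∙ y ∧ d ∉ K ∙ z ∧ z ∉ K ∙ y ∧ 2 ≤ finrank K (evalSpace (traceOrthogonal S) y) ∧
      2 ≤ finrank K (evalSpace (traceOrthogonal S) z) := by
  obtain ⟨y₀, hy₀⟩ : ∃ y₀, 2 ≤ finrank K (evalSpace (traceOrthogonal S) y₀) := by
    by_contra! h
    rcases codimOp_le_one_or_exists_finrank_evalSpace S fun y => Nat.lt_succ_iff.1 (h y) with
      h | ⟨u, hu, h⟩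
    · omega
    · have := hS u hu
      omega
  obtain ⟨y, hy, hyd⟩ : ∃ y, 2 ≤ finrank K (evalSpace (traceOrthogonal S) y) ∧ y ∉ K ∙ d := by
    obtain ⟨y, hy, -, hyd⟩ := exists_two_le_finrank_evalSpace_notMem he heV hy₀ d
    exact ⟨y, hy, hyd⟩
  obtain ⟨z, hz, hzy, hzd⟩ := exists_two_le_finrank_evalSpace_notMem he heV hy d
  exact ⟨y, z, notMem_span_singleton_comm hd hyd, notMem_span_singleton_comm hd hzd, hzy, hy, hz⟩

theorem isLocalMap_of_codimOp_add_two_mul_le (he : AvoidsThreeLines K e)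
    (hS : ∀ i, 0 < i → i < e → ¬ IsSpecialOfType S i) (hc : codimOp S + 2 * e ≤ 2 * finrank K V)
    (hd : d ≠ 0) (hF : QuasiRangeCompatibleWrt (K ∙ d) F) : IsLocalMap F := by
  induction hn : finrank K V generalizing V with
  | zero =>
    have := he.two_le
    omega
  | succ n ih =>
    by_cases hxe : ∃ x ≠ 0, finrank K (evalSpace S x) ≤ e
    · obtain ⟨x, hx, hxe⟩ := hxe
      exact isLocalMap_of_finrank_evalSpace_le he hS hc hd hF hx hxe
    by_cases hce : codimOp S + e ≤ finrank K V
    · exact isLocalMap_of_codimOp_add_le he hd hF hce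
    push Not at hxe hce
    have local_mod : ∀ y, d ∉ K ∙ y → 2 ≤ finrank K (evalSpace (traceOrthogonal S) y) →
        ∃ x : U, ∀ s : S, F s - (s : U →ₗ[K] V) x ∈ K ∙ y := by
      intro y hdy hy
      have hy₀ : y ≠ 0 := by
        rintro rfl
        simp [finrank_evalSpace_zero] at hy
      have hcodim := codimOp_modRange_add_finrank S y
      have hquotient := finrank_quotient_span_singleton_add_one (K := K) hy₀
      refine exists_sub_mem_span_of_modRange hdy hF fun G hG => ih ?_ (by omega)
        (mt (Quotient.mk_eq_zero _).1 hdy) hG (by omega)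
      rintro i hi hie ⟨x, rfl⟩
      have hx : x ≠ 0 := by
        rintro rfl
        simp [finrank_evalSpace_zero] at hi
      have := hxe x hx
      have := finrank_evalSpace_le_finrank_evalSpace_modRange_add_one S y x
      omega
    obtain ⟨y, z, hdy, hdz, hzy, hy, hz⟩ :=
      exists_two_le_finrank_evalSpace_traceOrthogonal he hce (by omega) hxe hd
    exact isLocalMap_of_sub_mem_span_singletons hzy
      (fun x hx => he.two_le.trans_lt (hxe x hx)) (local_mod y hdy hy) (local_mod z hdz hz)

end Induction

section PlaneTarget

open Module Submodule

variable {K U V : Type*} [Field K] [AddCommGroup U] [Module K U] [AddCommGroup V] [Module K V]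

/-- The linear forms with value `1` at the first vector of a basis of a plane, parametrized by
their value at the second. -/
noncomputable def pencilForm (b : Basis (Fin 2) K V) (l : K) : Dual K V :=
  b.coord 0 + l • b.coord 1

theorem pencilForm_apply (b : Basis (Fin 2) K V) (l : K) (v : V) :
    pencilForm b l v = b.repr v 0 + l * b.repr v 1 :=
  rfl

theorem pencilForm_apply_sub_smul (b : Basis (Fin 2) K V) (l m : K) :
    pencilForm b m (b 1 - l • b 0) = m - l := by
  simp [pencilForm_apply, sub_eq_neg_add]

theorem exists_basis_apply_zero_eq (hV : finrank K V = 2) {d : V} (hd : d ≠ 0) :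
    ∃ b : Basis (Fin 2) K V, b 0 = d := by
  obtain ⟨w, -, hw⟩ := exists_mem_notMem_of_finrank_lt (P := ⊤) (Q := K ∙ d)
    (by rw [finrank_top, hV, finrank_span_singleton hd]; exact one_lt_two)
  exact ⟨basisOfLinearIndependentOfCardEqFinrank
    (linearIndependent_pair_of_notMem_span_singleton hd hw) (by simp [hV]), by simp⟩

variable {S : Submodule K (U →ₗ[K] V)}

theorem eq_zero_of_smulRight_mem_traceOrthogonal [FiniteDimensional K V] {u : U}
    (hu : evalSpace S u = ⊤) {φ : Dual K V} (hφ : φ.smulRight u ∈ traceOrthogonal S) : φ = 0 := by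
  ext v
  obtain ⟨s, hs, rfl⟩ := mem_evalSpace.1 (hu ▸ mem_top : v ∈ evalSpace S u)
  exact smulRight_mem_traceOrthogonal.1 hφ s hs

variable [FiniteDimensional K U]

/-- Where `φ ∘ s = 0` the range of `s` misses `d`, so `φ (F s) = 0`: hence `s ↦ φ (F s)` factors
through `s ↦ φ ∘ s`. -/
theorem exists_apply_eq_apply_of_quasiRangeCompatibleWrt {d : V} {F : S →ₗ[K] V}
    (hF : QuasiRangeCompatibleWrt (K ∙ d) F) {φ : Dual K V} (hφ : φ d ≠ 0) :
    ∃ x : U, ∀ s : S, φ (F s) = φ ((s : U →ₗ[K] V) x) := by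
  rw [quasiRangeCompatibleWrt_span_singleton_iff] at hF
  let T : S →ₗ[K] Dual K U := (LinearMap.compRight K φ).domRestrict S
  have hrange : φ ∘ₗ F ∈ LinearMap.range T.dualMap := by
    rw [LinearMap.range_dualMap_eq_dualAnnihilator_ker, mem_dualAnnihilator]
    intro s hs
    have hφs : ∀ v ∈ LinearMap.range (s : U →ₗ[K] V), φ v = 0 := by
      rintro _ ⟨u, rfl⟩
      exact LinearMap.congr_fun hs u
    exact hφs _ (hF s fun h => hφ (hφs d h))
  obtain ⟨ξ, hξ⟩ := hrange
  obtain ⟨x, rfl⟩ := (evalEquiv K U).surjective ξ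
  exact ⟨x, fun s => (LinearMap.congr_fun hξ s).symm⟩

variable [FiniteDimensional K V]

theorem evalSpace_eq_top_of_not_isSpecialOfType_one (hV : finrank K V = 2) (hc : codimOp S ≤ 1)
    (hS : ¬ IsSpecialOfType S 1) {x : U} (hx : x ≠ 0) : evalSpace S x = ⊤ := by
  have hne : finrank K (evalSpace S x) ≠ 1 := fun h => hS ⟨x, h⟩
  have hcodim := codimOp_vanishingAt_add_finrank S hx
  have hle := Submodule.finrank_le (evalSpace S x)
  exact eq_top_of_finrank_eq (by omega)

variable {α β : K}

/-- Evaluate at `b 1 - l • b 0`, which `pencilForm b l` annihilates. -/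
theorem eq_zero_of_pencilForm_apply_eq (hα₀ : α ≠ 0) (hα₁ : α ≠ 1) (hβ₀ : β ≠ 0) (hβ₁ : β ≠ 1)
    (hαβ : α ≠ β) (hc : codimOp S ≤ 1) (hS : ∀ x ≠ 0, evalSpace S x = ⊤) (b : Basis (Fin 2) K V)
    {z : K → U} (hz : ∀ l, ∀ s ∈ S, pencilForm b l (s (z l)) = l * pencilForm b 1 (s (z 1))) :
    z 1 = 0 := by
  by_contra hz₁
  let t : K → V →ₗ[K] U := fun l =>
    (pencilForm b l).smulRight (z l) - l • (pencilForm b 1).smulRight (z 1)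
  have mem_orthogonal : ∀ l, t l ∈ traceOrthogonal S := fun l =>
    mem_traceOrthogonal.2 fun s hs => by
      rw [LinearMap.comp_sub, LinearMap.comp_smul, map_sub, map_smul, trace_comp_smulRight,
        trace_comp_smulRight, hz l s hs, smul_eq_mul, sub_self]
  have t_apply : ∀ l m, t m (b 1 - l • b 0) = (m - l) • z m - (m * (1 - l)) • z 1 := fun l m => by
    simp only [t, LinearMap.sub_apply, LinearMap.smul_apply, LinearMap.smulRight_apply,
      pencilForm_apply_sub_smul, smul_smul]
  have t_ne_zero : t α ≠ 0 := fun h => by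
    have hα := t_apply α α
    rw [h, LinearMap.zero_apply, sub_self, zero_smul, zero_sub, eq_comm, neg_eq_zero] at hα
    exact smul_ne_zero (mul_ne_zero hα₀ (sub_ne_zero.2 hα₁.symm)) hz₁ hα
  have orthogonal_eq : traceOrthogonal S = K ∙ t α :=
    eq_span_singleton_of_finrank_le_one (finrank_traceOrthogonal S ▸ hc) (mem_orthogonal α)
      t_ne_zero
  obtain ⟨c, hc⟩ := mem_span_singleton.1 (orthogonal_eq ▸ mem_orthogonal β)
  obtain ⟨k, hk⟩ : ∃ k : K, k • z 1 = z β := by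
    refine mem_span_singleton.1 ((smul_mem_iff _ (sub_ne_zero.2 hαβ.symm)).1 <|
      mem_span_singleton.2 ⟨β * (1 - α) - c * (α * (1 - α)), ?_⟩)
    have hα := t_apply α β
    rw [← hc, LinearMap.smul_apply, t_apply α α] at hα
    linear_combination (norm := module) hα
  have hβ : k • pencilForm b β - β • pencilForm b 1 = 0 := by
    refine eq_zero_of_smulRight_mem_traceOrthogonal (hS _ hz₁) ?_
    convert mem_orthogonal β using 1
    ext v
    simp only [t, ← hk, LinearMap.sub_apply, LinearMap.smul_apply, LinearMap.smulRight_apply,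
      smul_eq_mul]
    module
  have := LinearMap.congr_fun hβ (b 1 - β • b 0)
  simp [pencilForm_apply_sub_smul, hβ₀, sub_ne_zero.2 hβ₁.symm] at this

theorem isLocalMap_of_codimOp_le_one (hα₀ : α ≠ 0) (hα₁ : α ≠ 1) (hβ₀ : β ≠ 0) (hβ₁ : β ≠ 1)
    (hαβ : α ≠ β) (hV : finrank K V = 2) (hc : codimOp S ≤ 1)
    (hS : ¬ IsSpecialOfType S 1) {d : V} (hd : d ≠ 0) {F : S →ₗ[K] V}
    (hF : QuasiRangeCompatibleWrt (K ∙ d) F) : IsLocalMap F := by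
  obtain ⟨b, rfl⟩ := exists_basis_apply_zero_eq hV hd
  choose x hx using fun l => exists_apply_eq_apply_of_quasiRangeCompatibleWrt hF
    (φ := pencilForm b l) (by simp [pencilForm_apply])
  have hx₁₀ : x 1 - x 0 = 0 := by
    refine eq_zero_of_pencilForm_apply_eq hα₀ hα₁ hβ₀ hβ₁ hαβ hc
      (fun _ => evalSpace_eq_top_of_not_isSpecialOfType_one hV hc hS) b
      (z := fun l => x l - x 0) fun l s hs => ?_
    have h₀ := hx 0 ⟨s, hs⟩
    rw [map_sub, map_sub, map_sub, map_sub, ← hx l ⟨s, hs⟩, ← hx 1 ⟨s, hs⟩]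
    simp only [pencilForm_apply] at h₀ ⊢
    linear_combination (1 - l) * h₀
  refine ⟨x 0, fun s => b.ext_elem fun i => ?_⟩
  have h₀ := hx 0 s
  have h₁ := hx 1 s
  rw [sub_eq_zero.1 hx₁₀] at h₁
  simp only [pencilForm_apply] at h₀ h₁
  fin_cases i
  · simpa using h₀
  · simpa using by linear_combination h₁ - h₀

end PlaneTarget

theorem exists_ne_ne_ne_of_three_lt_card {α : Type*} (h : 3 < ENat.card α) (x y z : α) :
    ∃ a, a ≠ x ∧ a ≠ y ∧ a ≠ z := by
  classical
  obtain ⟨a, ha⟩ := Finset.exists_not_mem_of_card_lt_enatCard (s := {x, y, z})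
    ((Nat.cast_le.2 Finset.card_le_three).trans_lt h)
  exact ⟨a, by simpa using ha⟩

theorem mainTheorem7 {K U V : Type*} [Field K] [AddCommGroup U] [Module K U]
    [FiniteDimensional K U] [AddCommGroup V] [Module K V] [FiniteDimensional K V]
    (S : Submodule K (U →ₗ[K] V)) :
    (3 < ENat.card K → (codimOp S : ℤ) ≤ 2 * (Module.finrank K V : ℤ) - 3 →
        Module.finrank K V = 2 →
        IsSpecialOfType S 1 ∨ ∀ F : S →ₗ[K] V, QuasiRangeCompatible (⇑F) → IsLocalMap (⇑F)) ∧
    (2 < ENat.card K → (codimOp S : ℤ) ≤ 2 * (Module.finrank K V : ℤ) - 4 →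
        IsSpecialOfType S 1 ∨ ∀ F : S →+ V, QuasiRangeCompatible (⇑F) → IsLocalMap (⇑F)) ∧
    (ENat.card K = 2 → (codimOp S : ℤ) ≤ 2 * (Module.finrank K V : ℤ) - 6 →
        (IsSpecialOfType S 1 ∨ IsSpecialOfType S 2) ∨
          ∀ F : S →+ V, QuasiRangeCompatible (⇑F) → IsLocalMap (⇑F)) := by
  refine ⟨fun hK hc hV => or_iff_not_imp_left.2 fun hS F hF => ?_,
    fun hK hc => or_iff_not_imp_left.2 fun hS F hF => ?_,
    fun _ hc => or_iff_not_imp_left.2 fun hS F hF => ?_⟩ <;>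
    obtain ⟨d, hd, hF⟩ := hF.exists_span_singleton
  · obtain ⟨α, hα₀, hα₁⟩ := ENat.exists_ne_ne_of_three_le hK.le (0 : K) 1
    obtain ⟨β, hβ₀, hβ₁, hβα⟩ := exists_ne_ne_ne_of_three_lt_card hK 0 1 α
    exact isLocalMap_of_codimOp_le_one hα₀ hα₁ hβ₀ hβ₁ hβα.symm hV (by omega) hS hd hF
  · obtain ⟨α, hα⟩ := ENat.exists_ne_ne_of_three_le (Order.add_one_le_of_lt hK) (0 : K) 1
    refine isLocalMap_of_codimOp_add_two_mul_le (e := 2) (.inr ⟨le_rfl, α, hα⟩) (fun i hi hie => ?_)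
      (by omega) hd hF
    obtain rfl : i = 1 := by omega
    exact hS
  · refine isLocalMap_of_codimOp_add_two_mul_le (e := 3) (.inl le_rfl) (fun i hi hie => ?_)
      (by omega) hd hF
    obtain rfl | rfl : i = 1 ∨ i = 2 := by omega
    exacts [fun h => hS (.inl h), fun h => hS (.inr h)]
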